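/- For real parameters $(\beta_1,\beta_0)$ consider the IMEX linear multistep method $$u_n=\tfrac34u_{n-1}+\tfrac14u_{n-3}+\tfrac32\,\Delta t\,F_{n-1}+\sum_{j=0}^3\beta_j\,\Delta t\,G_{n-j},\qquad \beta_2=-3\beta_0-2\beta_1+3,\quad \beta_3=2\beta_0+\beta_1-\tfrac32 .$$ Applied to $\Delta t\,F=i\eta u$, $\Delta t\,G=\xi u$ with $\xi\le 0$, $\eta\in\mathbb R$, it has the characteristic polynomial $$P_{\beta_1,\beta_0}(\zeta,\xi,\eta)=(1-\beta_0\xi)\zeta^3-\Bigl(\tfrac34+\beta_1\xi+\tfrac{3i\eta}2\Bigr)\zeta^2+\xi(3\beta_0+2\beta_1-3)\zeta-\Bigl(\tfrac14+2\beta_0\xi+\beta_1\xi-\tfrac32\xi\Bigr).$$ Let $\mathcal S_{\beta_1,\beta_0}$ be the set of $(\xi,\eta)\in\mathbb R^2$ with $\xi\le0$ such that the polynomial $\zeta\mapsto P_{\beta_1,\beta_0}(\zeta,\xi,\eta)$ has degree at least $1$, all its roots lie in the closed unit disk, and its roots of modulus $1$ are simple. For $m>0$ let $\mathcal A_m=\{(\xi,\eta)\in\mathbb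 R^2:\xi\le0,\ |\eta|\le m|\xi|\}$, and let $$W=\Bigl\{(\beta_1,\beta_0)\in\mathbb R^2:\ \beta_1\le\tfrac34,\ \tfrac{3-2\beta_1}4\le\beta_0\le\tfrac{9-8\beta_1}8\Bigr\}.$$ Define the stability angle of the method $(\beta_1,\beta_0)$ as the supremum of all $\alpha\in(0,\pi/2)$ with $\mathcal A_{\tan\alpha}\subset\mathcal S_{\beta_1,\beta_0}$, and as $0$ if there is no such $\alpha$. **Theorem.** The largest $m>0$ such that $\mathcal A_m\subset\mathcal S_{\beta_1,\beta_0}$ for some $(\beta_1,\beta_0)\in W$ is $m=1/2$. For $(\beta_1,\beta_0)\in W$, the inclusion $\mathcal A_{1/2}\subset\mathcal S_{\beta_1,\beta_0}$ holds if and only if $(\beta_1,\beta_0)=(3/8,3/4)$. Consequently the largest stability angle among the methods with $(\beta_1,\beta_0)\in W$ is $\arctan(1/2)$, and $(3/8,3/4)$ is the only parameter pair in $W$ whose stability angle equals $\arctan(1/2)$. -/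

import Mathlib

namespace IMEX

open Polynomial

/-- `Q` is a simple von Neumann polynomial: `deg Q ≥ 1`, all roots lie in the closed unit disk,
and the roots of modulus `1` are simple. -/
def IsSimpleVonNeumann (Q : ℂ[X]) : Prop :=
  1 ≤ Q.natDegree ∧ ∀ ζ : ℂ, Q.IsRoot ζ → ‖ζ‖ ≤ 1 ∧ (‖ζ‖ = 1 → Q.rootMultiplicity ζ = 1)

/-- The characteristic polynomial `ζ ↦ P_{β₁,β₀}(ζ, ξ, η)` of the IMEX family. -/
noncomputable def charPoly (β₁ β₀ ξ η : ℝ) : ℂ[X] :=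
  C (1 - β₀ * ξ : ℂ) * X ^ 3
    - C (3 / 4 + β₁ * ξ + 3 * Complex.I * η / 2 : ℂ) * X ^ 2
    + C (ξ * (3 * β₀ + 2 * β₁ - 3) : ℂ) * X
    - C (1 / 4 + 2 * β₀ * ξ + β₁ * ξ - 3 / 2 * ξ : ℂ)

/-- The sequence `u n = ζ ^ n` satisfies the recurrence
`u_n = 3/4 u_{n-1} + 1/4 u_{n-3} + 3/2 Δt F_{n-1} + ∑_{j=0}^3 β_j Δt G_{n-j}`
with `Δt F_n = i η u_n`, `Δt G_n = ξ u_n`, `β₂ = 3 - 3 β₀ - 2 β₁`, `β₃ = 2 β₀ + β₁ - 3/2`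
(written with `n + 3` in place of `n`) whenever `ζ` is a root of `charPoly`, and conversely. -/
theorem geometric_solution_iff (β₁ β₀ ξ η : ℝ) (ζ : ℂ) :
    (∀ n : ℕ, ζ ^ (n + 3) = 3 / 4 * ζ ^ (n + 2) + 1 / 4 * ζ ^ n
        + 3 / 2 * (Complex.I * η * ζ ^ (n + 2))
        + (β₀ * (ξ * ζ ^ (n + 3)) + β₁ * (ξ * ζ ^ (n + 2))
          + (-3 * β₀ - 2 * β₁ + 3) * (ξ * ζ ^ (n + 1))
          + (2 * β₀ + β₁ - 3 / 2) * (ξ * ζ ^ n)))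
      ↔ (charPoly β₁ β₀ ξ η).IsRoot ζ := by
  simp only [charPoly, IsRoot.def, eval_add, eval_sub, eval_mul, eval_C, eval_pow, eval_X]
  constructor
  · intro h
    linear_combination h 0
  · intro h n
    linear_combination ζ ^ n * h

/-- The stability region `S_{β₁,β₀}`, a set of pairs `(ξ, η)`. -/
def stabilityRegion (β₁ β₀ : ℝ) : Set (ℝ × ℝ) :=
  {p | p.1 ≤ 0 ∧ IsSimpleVonNeumann (charPoly β₁ β₀ p.1 p.2)}

/-- The infinite sector `A_m`. -/
def sector (m : ℝ) : Set (ℝ × ℝ) :=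
  {p | p.1 ≤ 0 ∧ |p.2| ≤ m * |p.1|}

/-- The wedge `W` in the parameter plane, a set of pairs `(β₁, β₀)`. -/
def wedge : Set (ℝ × ℝ) :=
  {β | β.1 ≤ 3 / 4 ∧ (3 - 2 * β.1) / 4 ≤ β.2 ∧ β.2 ≤ (9 - 8 * β.1) / 8}

/-- `A(α)`-stability of the method with parameters `(β₁, β₀)`. -/
def IsAStable (β₁ β₀ α : ℝ) : Prop :=
  0 < α ∧ α < Real.pi / 2 ∧ sector (Real.tan α) ⊆ stabilityRegion β₁ β₀

/-- The stability angle of the method with parameters `(β₁, β₀)`: the supremum of all `α` for which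
the method is `A(α)`-stable (a set bounded by `π / 2`), and `0` if there is no such `α`. -/
noncomputable def stabilityAngle (β₁ β₀ : ℝ) : ℝ :=
  sSup {α : ℝ | IsAStable β₁ β₀ α}

end IMEX

namespace IMEX

/-! Write a = -ξ, K = 4β₀ + 2β₁ - 3 and R = `circleRe`. Dividing P by ζ² isolates iη. At ζ = 1 - t +
i√(t(2-t)) the real part of P = 0 reads a R(t) = t²/2, and the imaginary part then gives η = a ·
`locusSlope`. As t increases to the first zero t₀ of R, this boundary locus runs to infinity with
limiting slope (2/3)√(t₀(2-t₀)) K t₀. The upper edge of the wedge gives K t₀ ≤ 3/4 when t₀ < 2, and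
the square root is at most 1, so the slope is at most 1/2. Equality forces t₀ = 1 and determines
both parameters (`locusSlope_of_circleRe_eq_zero`). Repeating the computation on circles of radius
slightly above 1 yields unstable points in every wider sector
(`not_sector_subset_of_locusSlope_lt`).

For (3/8, 3/4) the ζ-coefficient of P vanishes, and the Schur–Cohn test reduces stability for ξ < 0
to one polynomial inequality, `optimal_discriminant_pos`. -/

open Polynomial ComplexConjugate Set Filter Topology

/-! ### Schur–Cohn recursion up to degree three. -/

section SchurCohn

/-- The basic step of the Schur–Cohn recursion. -/
theorem norm_conj_comb_le {p : ℝ} {c u v : ℂ} (hc : ‖c‖ < p) (huv : ‖v‖ ≤ ‖u‖) (hu : u ≠ 0) :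
    ‖p * v + conj c * u‖ ≤ ‖p * u + c * v‖ ∧ (p : ℂ) * u + c * v ≠ 0 := by
  have hp : 0 < p := (norm_nonneg c).trans_lt hc
  constructor
  · refine le_of_sq_le_sq ?_ (norm_nonneg _)
    have key : ‖p * u + c * v‖ ^ 2 - ‖p * v + conj c * u‖ ^ 2
        = (p ^ 2 - ‖c‖ ^ 2) * (‖u‖ ^ 2 - ‖v‖ ^ 2) := by
      simp only [Complex.sq_norm, Complex.normSq_apply, Complex.add_re, Complex.add_im,
        Complex.mul_re, Complex.mul_im, Complex.ofReal_re, Complex.ofReal_im, Complex.conj_re,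
        Complex.conj_im]
      ring
    have h1 : 0 ≤ p ^ 2 - ‖c‖ ^ 2 := sub_nonneg.2 (pow_le_pow_left₀ (norm_nonneg _) hc.le 2)
    have h2 : 0 ≤ ‖u‖ ^ 2 - ‖v‖ ^ 2 := sub_nonneg.2 (pow_le_pow_left₀ (norm_nonneg _) huv 2)
    linarith [mul_nonneg h1 h2]
  · intro h
    have h1 : ‖(p : ℂ) * u‖ = ‖c * v‖ := by
      rw [eq_neg_of_add_eq_zero_left h, norm_neg]
    rw [norm_mul, norm_mul, Complex.norm_real, Real.norm_of_nonneg hp.le] at h1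
    have h2 : 0 < ‖u‖ := norm_pos_iff.2 hu
    have h3 : ‖c‖ * ‖v‖ ≤ ‖c‖ * ‖u‖ := mul_le_mul_of_nonneg_left huv (norm_nonneg _)
    nlinarith

theorem linear_schur_cohn {p : ℝ} {c ζ : ℂ} (hc : ‖c‖ < p) (hζ : 1 ≤ ‖ζ‖) :
    ‖p + conj c * ζ‖ ≤ ‖p * ζ + c‖ ∧ (p : ℂ) * ζ + c ≠ 0 := by
  have := norm_conj_comb_le (u := ζ) (v := 1) hc (by simpa using hζ)
    (norm_pos_iff.1 (zero_lt_one.trans_le hζ))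
  simpa using this

/-- With Q* the reciprocal polynomial, Q is up to a positive factor a combination of ζL and L*, with
L linear. The bound |Q*| ≤ |Q| is kept because the next degree needs it as input. -/
theorem quadratic_schur_cohn {p : ℝ} {c₁ c₀ ζ : ℂ} (h₀ : ‖c₀‖ < p)
    (h₁ : ‖p * c₁ - c₀ * conj c₁‖ < p ^ 2 - ‖c₀‖ ^ 2) (hζ : 1 ≤ ‖ζ‖) :
    ‖p + conj c₁ * ζ + conj c₀ * ζ ^ 2‖ ≤ ‖p * ζ ^ 2 + c₁ * ζ + c₀‖ ∧
      (p : ℂ) * ζ ^ 2 + c₁ * ζ + c₀ ≠ 0 := by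
  set d := p ^ 2 - ‖c₀‖ ^ 2 with hd
  have hd0 : 0 < d := (norm_nonneg _).trans_lt h₁
  have hdc : (d : ℂ) = p ^ 2 - c₀ * conj c₀ := by
    rw [Complex.mul_conj', hd]; push_cast; ring
  obtain ⟨hle, hne⟩ := linear_schur_cohn h₁ hζ
  set L := (d : ℂ) * ζ + (p * c₁ - c₀ * conj c₁)
  have hζ0 : ζ ≠ 0 := norm_pos_iff.1 (zero_lt_one.trans_le hζ)
  obtain ⟨h1, h2⟩ := norm_conj_comb_le (u := ζ * L) h₀ (hle.trans (by
    rw [norm_mul]; exact le_mul_of_one_le_left (norm_nonneg _) hζ)) (mul_ne_zero hζ0 hne)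
  have e1 : (p : ℂ) * (ζ * L) + c₀ * (d + conj (p * c₁ - c₀ * conj c₁) * ζ)
      = d * (p * ζ ^ 2 + c₁ * ζ + c₀) := by
    simp only [L, map_sub, map_mul, Complex.conj_ofReal, Complex.conj_conj, hdc]; ring
  have e2 : (p : ℂ) * (d + conj (p * c₁ - c₀ * conj c₁) * ζ) + conj c₀ * (ζ * L)
      = d * (p + conj c₁ * ζ + conj c₀ * ζ ^ 2) := by
    simp only [L, map_sub, map_mul, Complex.conj_ofReal, Complex.conj_conj, hdc]; ring
  rw [e1] at h2
  rw [e1, e2, norm_mul, norm_mul, Complex.norm_real, Real.norm_of_nonneg hd0.le] at h1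
  exact ⟨le_of_mul_le_mul_left h1 hd0, right_ne_zero_of_mul h2⟩

/-- The Schur–Cohn criterion: a sufficient condition for a cubic to have no root outside the open
unit disk. -/
theorem cubic_schur_cohn {p : ℝ} {c₂ c₁ c₀ ζ : ℂ} {d : ℝ} (hd : d = p ^ 2 - ‖c₀‖ ^ 2)
    {q₁ q₀ : ℂ} (hq₁ : q₁ = p * c₂ - c₀ * conj c₁) (hq₀ : q₀ = p * c₁ - c₀ * conj c₂)
    (h₀ : ‖c₀‖ < p) (h₁ : ‖q₀‖ < d) (h₂ : ‖d * q₁ - q₀ * conj q₁‖ < d ^ 2 - ‖q₀‖ ^ 2)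
    (hζ : 1 ≤ ‖ζ‖) :
    (p : ℂ) * ζ ^ 3 + c₂ * ζ ^ 2 + c₁ * ζ + c₀ ≠ 0 := by
  have hdc : (d : ℂ) = p ^ 2 - c₀ * conj c₀ := by
    rw [Complex.mul_conj', hd]; push_cast; ring
  obtain ⟨hle, hne⟩ := quadratic_schur_cohn h₁ h₂ hζ
  have hζ0 : ζ ≠ 0 := norm_pos_iff.1 (zero_lt_one.trans_le hζ)
  obtain ⟨-, h⟩ := norm_conj_comb_le (u := ζ * (d * ζ ^ 2 + q₁ * ζ + q₀)) h₀ (hle.trans (by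
    rw [norm_mul]; exact le_mul_of_one_le_left (norm_nonneg _) hζ)) (mul_ne_zero hζ0 hne)
  have e : (p : ℂ) * (ζ * (d * ζ ^ 2 + q₁ * ζ + q₀))
      + c₀ * (d + conj q₁ * ζ + conj q₀ * ζ ^ 2)
      = d * (p * ζ ^ 3 + c₂ * ζ ^ 2 + c₁ * ζ + c₀) := by
    simp only [hq₁, hq₀, map_sub, map_mul, Complex.conj_ofReal, Complex.conj_conj, hdc]; ring
  rw [e] at h
  exact right_ne_zero_of_mul h

end SchurCohn

/-! ### Stability of the optimal method. -/

section Optimal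

theorem eval_charPoly (β₁ β₀ ξ η : ℝ) (ζ : ℂ) :
    (charPoly β₁ β₀ ξ η).eval ζ = (1 - β₀ * ξ) * ζ ^ 3
      - (3 / 4 + β₁ * ξ + 3 * Complex.I * η / 2) * ζ ^ 2
      + ξ * (3 * β₀ + 2 * β₁ - 3) * ζ
      - (1 / 4 + 2 * β₀ * ξ + β₁ * ξ - 3 / 2 * ξ) := by
  simp only [charPoly, eval_add, eval_sub, eval_mul, eval_C, eval_pow, eval_X]

/-- The expression is concave in y, with leading coefficient -(1/4 - b)². It splits into a
nonnegative multiple of y(4b² - y) and a linear part that decreases in y and is still positive at y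
= 4b². -/
theorem optimal_discriminant_pos {b y : ℝ} (hb : 0 < b) (hy : 0 ≤ y) (hyb : y ≤ 4 * b ^ 2) :
    0 < ((1 + 2 * b) ^ 2 - (1 / 4 - b) ^ 2) ^ 3
      - (2 * (1 / 4 - b) ^ 2 + (1 + 2 * b) ^ 2) * ((1 + 2 * b) ^ 2 - (1 / 4 - b) ^ 2)
        * ((3 / 4 - b) ^ 2 + y)
      - 2 * (1 + 2 * b) ^ 2 * (1 / 4 - b) * ((3 / 4 - b) ^ 3 - 3 * (3 / 4 - b) * y)
      - (1 / 4 - b) ^ 2 * ((3 / 4 - b) ^ 2 + y) ^ 2 := by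
  have h1 : 0 ≤ (4 * b ^ 2 - y) * (69 / 8 * b + 39 * b ^ 2 + 30 * b ^ 3) :=
    mul_nonneg (by linarith) (by positivity)
  have h2 : 0 ≤ (1 / 4 - b) ^ 2 * (y * (4 * b ^ 2 - y)) :=
    mul_nonneg (sq_nonneg _) (mul_nonneg hy (by linarith))
  have h3 : 0 < 81 / 8 * b + 63 * b ^ 2 + 271 / 2 * b ^ 3 + 68 * b ^ 4 + 8 * b ^ 5 := by positivity
  linear_combination h1 + h2 + h3

theorem optimal_eval_ne_zero {ξ η : ℝ} (hξ : ξ < 0) (hη : |η| ≤ 1 / 2 * |ξ|) {ζ : ℂ}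
    (hζ : 1 ≤ ‖ζ‖) : (charPoly (3 / 8) (3 / 4) ξ η).eval ζ ≠ 0 := by
  obtain ⟨b, hb⟩ : ∃ b, b = -(3 / 8 * ξ) := ⟨_, rfl⟩
  obtain ⟨E, hE⟩ : ∃ E, E = 3 / 2 * η := ⟨_, rfl⟩
  have hb0 : 0 < b := by linarith
  -- The sector condition: |E| = (3/2)|η| ≤ (3/4)|ξ| = 2b.
  have hE2 : E ^ 2 ≤ 4 * b ^ 2 := by
    have : |E| ≤ |2 * b| := by
      rw [hE, hb, abs_mul, abs_of_pos (show (0 : ℝ) < 3 / 2 by norm_num),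
        show 2 * -(3 / 8 * ξ) = 3 / 4 * -ξ by ring, abs_mul, abs_neg,
        abs_of_pos (show (0 : ℝ) < 3 / 4 by norm_num)]
      linarith
    nlinarith [sq_le_sq.2 this]
  set A := 1 + 2 * b with hA
  set B := 1 / 4 - b with hB
  set p : ℂ := ⟨3 / 4 - b, E⟩ with hp
  set d := A ^ 2 - B ^ 2 with hd
  have hA0 : 0 < A := by positivity
  have hBA : |B| < A := abs_lt.2 ⟨by linarith, by linarith⟩
  have hd0 : 0 < d := by
    rw [hd, ← sq_abs B]; exact sub_pos.2 (pow_lt_pow_left₀ hBA (abs_nonneg _) two_ne_zero)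
  have hdb : d = 15 / 16 + 9 / 2 * b + 3 * b ^ 2 := by rw [hd, hA, hB]; ring
  have hx : ‖p‖ ^ 2 = (3 / 4 - b) ^ 2 + E ^ 2 := by
    rw [Complex.sq_norm, Complex.normSq_apply]; ring
  have hN0 : ‖((B : ℂ) * conj p)‖ ^ 2 = B ^ 2 * ((3 / 4 - b) ^ 2 + E ^ 2) := by
    rw [norm_mul, Complex.norm_conj, mul_pow, hx, Complex.norm_real, Real.norm_eq_abs, sq_abs]
  have hS : 0 < d ^ 2 - ‖((B : ℂ) * conj p)‖ ^ 2 := by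
    rw [hN0, hdb, hB]
    have h1 : 0 ≤ (1 / 4 - b) ^ 2 * (4 * b ^ 2 - E ^ 2) :=
      mul_nonneg (sq_nonneg _) (by linarith)
    have h2 : 0 < 27 / 32 + 35 / 4 * b + 22 * b ^ 2 + 20 * b ^ 3 + 4 * b ^ 4 := by positivity
    nlinarith [pow_pos hb0 2, pow_pos hb0 3, pow_pos hb0 4]
  have key := cubic_schur_cohn (p := A) (c₂ := -p) (c₁ := 0) (c₀ := -(B : ℂ)) (d := d)
    (q₁ := -(A * p)) (q₀ := -(B * conj p)) (ζ := ζ) ?_ ?_ ?_ ?_ ?_ ?_ hζ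
  · rw [eval_charPoly]
    convert key using 1
    rw [hp, Complex.mk_eq_add_mul_I, hA, hB, hb, hE]
    push_cast
    ring
  · rw [norm_neg, Complex.norm_real, Real.norm_eq_abs, sq_abs]
  · simp
  · simp
  · rwa [norm_neg, Complex.norm_real, Real.norm_eq_abs]
  · rw [norm_neg]
    exact lt_of_pow_lt_pow_left₀ 2 hd0.le (by linarith)
  · rw [norm_neg]
    refine lt_of_pow_lt_pow_left₀ 2 hS.le ?_
    have e : ‖(d : ℂ) * -(A * p) - -(B * conj p) * conj (-(A * p))‖ ^ 2
        = A ^ 2 * (d ^ 2 * ((3 / 4 - b) ^ 2 + E ^ 2)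
          + B ^ 2 * ((3 / 4 - b) ^ 2 + E ^ 2) ^ 2
          + 2 * d * B * ((3 / 4 - b) ^ 3 - 3 * (3 / 4 - b) * E ^ 2)) := by
      rw [Complex.sq_norm, Complex.normSq_apply]
      simp only [hp, Complex.sub_re, Complex.sub_im, Complex.neg_re, Complex.neg_im,
        Complex.mul_re, Complex.mul_im, Complex.ofReal_re, Complex.ofReal_im, Complex.conj_re,
        Complex.conj_im]
      ring
    rw [e, hN0]
    -- The last Schur–Cohn condition, squared, is divisible by d = A² - B²; the cofactor is the
    -- discriminant.
    have hD := mul_pos hd0 (optimal_discriminant_pos hb0 (sq_nonneg E) hE2)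
    rw [← hA, ← hB, ← hd] at hD
    rw [← sub_pos]
    convert hD using 1
    rw [hd]
    ring

theorem one_le_natDegree_charPoly {β₁ β₀ ξ η : ℝ} (h : 1 - β₀ * ξ ≠ 0) :
    1 ≤ (charPoly β₁ β₀ ξ η).natDegree := by
  refine le_trans (by norm_num) (le_natDegree_of_ne_zero (n := 3) ?_)
  have : (charPoly β₁ β₀ ξ η).coeff 3 = ((1 - β₀ * ξ : ℝ) : ℂ) := by
    simp [charPoly, -map_sub, -map_add, -map_mul, coeff_C_mul, coeff_X_pow]
  rw [this]
  exact_mod_cast h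

theorem isSimpleVonNeumann_charPoly_zero (β₁ β₀ : ℝ) :
    IsSimpleVonNeumann (charPoly β₁ β₀ 0 0) := by
  refine ⟨one_le_natDegree_charPoly (by simp), fun ζ hζ => ?_⟩
  have hf : (ζ - 1) * (ζ ^ 2 + ζ / 4 + 1 / 4) = 0 := by
    rw [IsRoot.def, eval_charPoly] at hζ
    push_cast at hζ
    linear_combination hζ
  rcases mul_eq_zero.1 hf with h | h
  · obtain rfl : ζ = 1 := sub_eq_zero.1 h
    refine ⟨by simp, fun _ => ?_⟩
    have hne : charPoly β₁ β₀ 0 0 ≠ 0 :=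
      ne_zero_of_natDegree_gt (one_le_natDegree_charPoly (by simp))
    refine le_antisymm (not_lt.1 fun hlt => ?_) ((rootMultiplicity_pos hne).2 hζ)
    have := ((one_lt_rootMultiplicity_iff_isRoot hne).1 hlt).2
    simp [charPoly, IsRoot.def] at this
    norm_num at this
  · have hlt : ‖ζ‖ < 1 := by
      by_contra! hge
      have e : ζ ^ 2 = -(ζ / 4 + 1 / 4) := by linear_combination h
      have h1 : ‖ζ‖ ^ 2 ≤ ‖ζ‖ / 4 + 1 / 4 := by
        rw [← norm_pow, e, norm_neg]
        exact (norm_add_le _ _).trans (by simp)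
      nlinarith
    exact ⟨hlt.le, fun h1 => absurd h1 hlt.ne⟩

theorem sector_half_subset : sector (1 / 2) ⊆ stabilityRegion (3 / 8) (3 / 4) := by
  rintro ⟨ξ, η⟩ ⟨hξ, hη⟩
  refine ⟨hξ, ?_⟩
  dsimp only at hξ hη ⊢
  rcases hξ.lt_or_eq with hneg | rfl
  · refine ⟨one_le_natDegree_charPoly (by linarith), fun ζ hζ => ?_⟩
    have hlt : ‖ζ‖ < 1 := not_le.1 fun hge => optimal_eval_ne_zero hneg hη hge hζ
    exact ⟨hlt.le, fun h1 => absurd h1 hlt.ne⟩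
  · obtain rfl : η = 0 := by simpa using hη
    exact isSimpleVonNeumann_charPoly_zero _ _

end Optimal

/-! ### Boundary locus and loss of stability. -/

section Instability

/-- On the unit circle, at `ζ = c + s i` with `t = 1 - c`, the real part of `ζ⁻²` times the
generating polynomial of the implicit part. -/
noncomputable def circleRe (β₁ β₀ t : ℝ) : ℝ :=
  3 / 2 - (6 * β₀ + 2 * β₁ - 3) * t + (4 * β₀ + 2 * β₁ - 3) * t ^ 2

/-- The ratio `η / |ξ|` along the boundary locus. -/
noncomputable def locusSlope (β₁ β₀ t : ℝ) : ℝ :=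
  2 / 3 * √(t * (2 - t)) *
    ((3 - t) * circleRe β₁ β₀ t / t ^ 2 + (4 * β₀ + 2 * β₁ - 3) * t)

theorem not_sector_subset_of_root {β₁ β₀ m ξ η : ℝ} {ζ : ℂ} (hξ : ξ ≤ 0) (hη : |η| ≤ m * |ξ|)
    (hζ : 1 < ‖ζ‖) (h : (charPoly β₁ β₀ ξ η).eval ζ = 0) :
    ¬ sector m ⊆ stabilityRegion β₁ β₀ := fun hsub =>
  absurd (((hsub (show (ξ, η) ∈ sector m from ⟨hξ, hη⟩)).2.2 ζ h).1) (not_le.2 hζ)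

theorem not_sector_subset_of_locusSlope_lt {β₁ β₀ m t : ℝ}
    (hK : 0 ≤ 4 * β₀ + 2 * β₁ - 3) (ht0 : 0 < t) (ht2 : t < 2)
    (hR : 0 < circleRe β₁ β₀ t) (hm : locusSlope β₁ β₀ t < m) :
    ¬ sector m ⊆ stabilityRegion β₁ β₀ := by
  obtain ⟨s, hs⟩ : ∃ s, s = √(t * (2 - t)) := ⟨_, rfl⟩
  obtain ⟨c, hc⟩ : ∃ c, c = 1 - t := ⟨_, rfl⟩
  have hs0 : 0 ≤ s := hs ▸ Real.sqrt_nonneg _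
  have hs2 : s ^ 2 = t * (2 - t) := by
    rw [hs, Real.sq_sqrt (mul_nonneg ht0.le (by linarith))]
  have hcs : c ^ 2 + s ^ 2 = 1 := by rw [hs2, hc]; ring
  -- Real and imaginary parts, at ζ = r(c + is), of the two pieces in P/ζ² = F + aG - (3/2)iη.
  -- Solving for a and η makes ζ a root of modulus r.
  let Fre : ℝ → ℝ := fun r => r * c - 3 / 4 - r⁻¹ ^ 2 * (c ^ 2 - s ^ 2) / 4
  let Fim : ℝ → ℝ := fun r => r * s + r⁻¹ ^ 2 * (2 * c * s) / 4
  let Gre : ℝ → ℝ := fun r => β₀ * (r * c) + β₁ - (3 * β₀ + 2 * β₁ - 3) * (r⁻¹ * c)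
    + (2 * β₀ + β₁ - 3 / 2) * (r⁻¹ ^ 2 * (c ^ 2 - s ^ 2))
  let Gim : ℝ → ℝ := fun r => β₀ * (r * s) + (3 * β₀ + 2 * β₁ - 3) * (r⁻¹ * s)
    - (2 * β₀ + β₁ - 3 / 2) * (r⁻¹ ^ 2 * (2 * c * s))
  let a : ℝ → ℝ := fun r => -Fre r / Gre r
  let e : ℝ → ℝ := fun r => 2 / 3 * (Fim r + a r * Gim r)
  have hinv : ContinuousAt (fun r : ℝ => r⁻¹) 1 := continuousAt_inv₀ one_ne_zero
  have cFre : ContinuousAt Fre 1 := by fun_prop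
  have cFim : ContinuousAt Fim 1 := by fun_prop
  have cGre : ContinuousAt Gre 1 := by fun_prop
  have cGim : ContinuousAt Gim 1 := by fun_prop
  have vF : Fre 1 = -(t ^ 2 / 2) := by
    simp only [Fre, inv_one, one_pow, hs2, hc]; ring
  have vFi : Fim 1 = s * (3 - t) / 2 := by
    simp only [Fim, inv_one, one_pow, hc]; ring
  have vG : Gre 1 = circleRe β₁ β₀ t := by
    simp only [Gre, circleRe, inv_one, one_pow, hs2, hc]; ring
  have vGi : Gim 1 = s * ((4 * β₀ + 2 * β₁ - 3) * t) := by
    simp only [Gim, inv_one, one_pow, hc]; ring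
  have hG1 : Gre 1 ≠ 0 := vG ▸ hR.ne'
  have ca : ContinuousAt a 1 := (cFre.neg).div cGre hG1
  have ce : ContinuousAt e 1 := by fun_prop
  have va : a 1 = t ^ 2 / 2 / circleRe β₁ β₀ t := by simp only [a, vF, vG, neg_neg]
  have ha1 : 0 < a 1 := by rw [va]; positivity
  have ve : e 1 = a 1 * locusSlope β₁ β₀ t := by
    simp only [e, vFi, vGi, locusSlope, ← hs, va]
    field_simp
  have hslope : 0 ≤ locusSlope β₁ β₀ t := by
    have : 0 ≤ 3 - t := by linarith
    unfold locusSlope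
    positivity
  have he1 : |e 1| < m * a 1 := by
    rw [ve, abs_of_nonneg (mul_nonneg ha1.le hslope), mul_comm]
    exact mul_lt_mul_of_pos_right hm ha1
  -- The strict inequalities at r = 1 survive for r slightly above 1, where the root lies outside
  -- the disk.
  have hev : ∀ᶠ r in 𝓝[>] (1 : ℝ), 0 < a r ∧ Gre r ≠ 0 ∧ |e r| < m * a r ∧ 1 < r := by
    have h1 := ca.eventually_const_lt ha1
    have h2 := cGre.eventually_ne hG1
    have h3 := ce.abs.eventually_lt (continuousAt_const.mul ca) he1
    filter_upwards [nhdsWithin_le_nhds h1, nhdsWithin_le_nhds h2, nhdsWithin_le_nhds h3,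
      self_mem_nhdsWithin] with r h1 h2 h3 h4 using ⟨h1, h2, h3, h4⟩
  obtain ⟨r, har, hGr, her, hr⟩ := hev.exists
  have hr0 : 0 < r := zero_lt_one.trans hr
  have hre : Fre r + a r * Gre r = 0 := by
    simp only [a]; field_simp; ring
  have him : Fim r + a r * Gim r = 3 / 2 * e r := by
    simp only [e]; ring
  refine not_sector_subset_of_root (ξ := -a r) (η := e r) (ζ := r * (c + s * Complex.I))
    (by linarith) (by rw [abs_neg, abs_of_pos har]; exact her.le) ?_ ?_
  · have h1 : ‖(c + s * Complex.I : ℂ)‖ = 1 := by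
      rw [Complex.norm_add_mul_I, hcs, Real.sqrt_one]
    rwa [norm_mul, h1, mul_one, Complex.norm_real, Real.norm_of_nonneg hr0.le]
  · rw [eval_charPoly]
    have hreC : (Fre r : ℂ) + a r * Gre r = 0 := by exact_mod_cast hre
    have himC : (Fim r : ℂ) + a r * Gim r = 3 / 2 * e r := by
      have := congrArg Complex.ofReal him
      push_cast at this
      exact this
    obtain ⟨w, hw⟩ : ∃ w : ℂ, w = (r : ℂ)⁻¹ * (c - s * Complex.I) := ⟨_, rfl⟩
    obtain ⟨ζ, hζ⟩ : ∃ ζ : ℂ, ζ = r * (c + s * Complex.I) := ⟨_, rfl⟩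
    have hI := Complex.I_sq
    have hζw : ζ * w = 1 := by
      have hrC : (r : ℂ) ≠ 0 := by exact_mod_cast hr0.ne'
      have hcsC : (c : ℂ) ^ 2 + s ^ 2 = 1 := by exact_mod_cast hcs
      rw [hζ, hw]
      field_simp
      linear_combination hcsC - s ^ 2 * hI
    have hF : (Fre r : ℂ) + Fim r * Complex.I = ζ - 3 / 4 - w ^ 2 / 4 := by
      simp only [Fre, Fim, hζ, hw]
      push_cast
      linear_combination (r : ℂ)⁻¹ ^ 2 * s ^ 2 / 4 * hI
    have hG : (Gre r : ℂ) + Gim r * Complex.I = β₀ * ζ + β₁ - (3 * β₀ + 2 * β₁ - 3) * w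
        + (2 * β₀ + β₁ - 3 / 2) * w ^ 2 := by
      simp only [Gre, Gim, hζ, hw]
      push_cast
      linear_combination -(2 * β₀ + β₁ - 3 / 2) * (r : ℂ)⁻¹ ^ 2 * s ^ 2 * hI
    have hfac : ζ - 3 / 4 - w ^ 2 / 4 + a r * (β₀ * ζ + β₁ - (3 * β₀ + 2 * β₁ - 3) * w
        + (2 * β₀ + β₁ - 3 / 2) * w ^ 2) - 3 / 2 * e r * Complex.I = 0 := by
      rw [← hF, ← hG]
      linear_combination hreC + Complex.I * himC
    have hw2 : ζ ^ 2 * w ^ 2 = 1 := by rw [← mul_pow, hζw, one_pow]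
    rw [← hζ]
    push_cast
    linear_combination ζ ^ 2 * hfac + (1 / 4 - a r * (2 * β₀ + β₁ - 3 / 2)) * hw2
      + a r * (3 * β₀ + 2 * β₁ - 3) * ζ * hζw

theorem exists_first_zero_circleRe {β : ℝ × ℝ} (hβ : β ∈ wedge) :
    ∃ t₀, 0 < t₀ ∧ t₀ ≤ 2 ∧ circleRe β.1 β.2 t₀ = 0 ∧
      ∀ t, 0 ≤ t → t < t₀ → 0 < circleRe β.1 β.2 t := by
  obtain ⟨-, -, h3⟩ := hβ
  have hcont : Continuous (circleRe β.1 β.2) := by unfold circleRe; fun_prop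
  have h0 : 0 < circleRe β.1 β.2 0 := by norm_num [circleRe]
  -- This is exactly the upper edge of the wedge.
  have h2 : circleRe β.1 β.2 2 ≤ 0 := by unfold circleRe; linarith
  have hne : (Icc (0 : ℝ) 2 ∩ circleRe β.1 β.2 ⁻¹' {0}).Nonempty :=
    intermediate_value_Icc' zero_le_two hcont.continuousOn ⟨h2, h0.le⟩
  have hcomp : IsCompact (Icc (0 : ℝ) 2 ∩ circleRe β.1 β.2 ⁻¹' {0}) :=
    isCompact_Icc.inter_right (isClosed_singleton.preimage hcont)
  obtain ⟨t₀, ⟨⟨ht0, ht2⟩, hz⟩, hmin⟩ := hcomp.exists_isLeast hne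
  have hz' : circleRe β.1 β.2 t₀ = 0 := hz
  refine ⟨t₀, ht0.lt_of_ne ?_, ht2, hz', fun t ht htt => ?_⟩
  · rintro rfl; exact h0.ne' hz'
  · by_contra! hle
    obtain ⟨u, ⟨hu0, hut⟩, hu⟩ :=
      intermediate_value_Icc' ht hcont.continuousOn ⟨hle, h0.le⟩
    exact absurd (hmin ⟨⟨hu0, by linarith⟩, hu⟩) (not_le.2 (hut.trans_lt htt))

theorem locusSlope_of_circleRe_eq_zero {β : ℝ × ℝ} (hβ : β ∈ wedge) {t : ℝ} (ht0 : 0 < t)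
    (ht2 : t ≤ 2) (hz : circleRe β.1 β.2 t = 0) :
    locusSlope β.1 β.2 t ≤ 1 / 2 ∧ (locusSlope β.1 β.2 t = 1 / 2 → β = (3 / 8, 3 / 4)) := by
  obtain ⟨h1, h2, h3⟩ := hβ
  have hs2 : √(t * (2 - t)) ^ 2 = t * (2 - t) :=
    Real.sq_sqrt (mul_nonneg ht0.le (by linarith))
  have hs0 : 0 ≤ √(t * (2 - t)) := Real.sqrt_nonneg _
  have hf : locusSlope β.1 β.2 t = 2 / 3 * √(t * (2 - t)) * ((4 * β.2 + 2 * β.1 - 3) * t) := by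
    simp [locusSlope, hz]
  rw [hf]
  set s := √(t * (2 - t)) with hs
  set x := (4 * β.2 + 2 * β.1 - 3) * t with hx
  have hs1 : s ≤ 1 := by nlinarith [sq_nonneg (t - 1)]
  rcases ht2.lt_or_eq with hlt | rfl
  · have hzx : x * (2 - t) = 3 / 2 - (3 - 2 * β.2 - 2 * β.1) * t := by
      unfold circleRe at hz; rw [hx]; linarith
    -- Since 3 - 2β₀ - 2β₁ ≥ 3/4 in the wedge, x(2 - t) ≤ (3/4)(2 - t).
    have hx34 : x ≤ 3 / 4 := by nlinarith
    have hx0 : 0 ≤ x := mul_nonneg (by linarith) ht0.le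
    refine ⟨by nlinarith, fun heq => ?_⟩
    have hs1' : s = 1 := by nlinarith
    have ht1 : t = 1 := by
      rw [hs1'] at hs2
      have : (t - 1) ^ 2 = 0 := by linarith
      exact sub_eq_zero.1 (pow_eq_zero_iff two_ne_zero |>.1 this)
    rw [hs1'] at heq
    rw [ht1] at hx hzx
    exact Prod.ext (by dsimp only; linarith) (by dsimp only; linarith)
  · have : s = 0 := by rw [hs]; norm_num
    rw [this]; norm_num

/-- Every method in the wedge loses stability in sectors of slope above some `μ ≤ 1 / 2`, and
`μ < 1 / 2` unless the method is the optimal one. -/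
theorem exists_slope_bound {β : ℝ × ℝ} (hβ : β ∈ wedge) :
    ∃ μ, μ ≤ 1 / 2 ∧ (μ = 1 / 2 → β = (3 / 8, 3 / 4)) ∧
      ∀ m, μ < m → ¬ sector m ⊆ stabilityRegion β.1 β.2 := by
  obtain ⟨t₀, h0, h2, hz, hpos⟩ := exists_first_zero_circleRe hβ
  obtain ⟨hle, heq⟩ := locusSlope_of_circleRe_eq_zero hβ h0 h2 hz
  refine ⟨_, hle, heq, fun m hm => ?_⟩
  have hcont : ContinuousAt (locusSlope β.1 β.2) t₀ := by
    have : t₀ ^ 2 ≠ 0 := by positivity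
    unfold locusSlope circleRe
    fun_prop (disch := assumption)
  -- At t₀ itself a is infinite; just below t₀ it is finite and positive, and the slope is still
  -- below m.
  have hev : ∀ᶠ t in 𝓝[<] t₀, locusSlope β.1 β.2 t < m ∧ 0 < t ∧ t < t₀ := by
    filter_upwards [nhdsWithin_le_nhds (hcont.eventually_lt_const hm),
      nhdsWithin_le_nhds (lt_mem_nhds h0), self_mem_nhdsWithin] with t a b c using ⟨a, b, c⟩
  obtain ⟨t, hslope, ht0, htt⟩ := hev.exists
  exact not_sector_subset_of_locusSlope_lt (by linarith [hβ.2.1]) ht0 (htt.trans_le h2)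
    (hpos t ht0.le htt) hslope

end Instability

/-! ### From sector slopes to stability angles. -/

section StabilityAngle

theorem sector_mono {m m' : ℝ} (h : m ≤ m') : sector m ⊆ sector m' := fun _ hp =>
  ⟨hp.1, hp.2.trans (mul_le_mul_of_nonneg_right h (abs_nonneg _))⟩

theorem optimal_mem_wedge : ((3 / 8, 3 / 4) : ℝ × ℝ) ∈ wedge := by
  refine ⟨?_, ?_, ?_⟩ <;> norm_num

/-- If no sector of slope above `μ` is stable, then the stability angle is at most `arctan μ`. -/
theorem le_arctan_of_isAStable {β₁ β₀ μ α : ℝ}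
    (h : ∀ m, μ < m → ¬ sector m ⊆ stabilityRegion β₁ β₀) (hα : IsAStable β₁ β₀ α) :
    α ≤ Real.arctan μ := by
  obtain ⟨h0, h1, h2⟩ := hα
  have : Real.tan α ≤ μ := not_lt.1 fun hlt => h _ hlt h2
  rw [← Real.arctan_tan (by linarith) h1]
  exact Real.arctan_strictMono.monotone this

theorem stabilityAngle_le_arctan {β₁ β₀ μ : ℝ} (hμ : 0 ≤ μ)
    (h : ∀ m, μ < m → ¬ sector m ⊆ stabilityRegion β₁ β₀) :
    stabilityAngle β₁ β₀ ≤ Real.arctan μ :=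
  Real.sSup_le (fun _ hα => le_arctan_of_isAStable h hα) (Real.arctan_nonneg.2 hμ)

theorem stabilityAngle_le {β : ℝ × ℝ} (hβ : β ∈ wedge) :
    stabilityAngle β.1 β.2 ≤ Real.arctan (1 / 2) := by
  obtain ⟨μ, hμ, -, h⟩ := exists_slope_bound hβ
  exact stabilityAngle_le_arctan (by norm_num) fun m hm => h m (hμ.trans_lt hm)

theorem stabilityAngle_optimal : stabilityAngle (3 / 8) (3 / 4) = Real.arctan (1 / 2) := by
  refine le_antisymm (stabilityAngle_le (β := (3 / 8, 3 / 4)) optimal_mem_wedge) ?_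
  have hbdd : BddAbove {α : ℝ | IsAStable (3 / 8) (3 / 4) α} :=
    ⟨Real.pi / 2, fun α hα => hα.2.1.le⟩
  refine le_csSup hbdd ⟨?_, Real.arctan_lt_pi_div_two _, ?_⟩
  · exact Real.arctan_pos.2 (by norm_num)
  · rw [Real.tan_arctan]
    exact sector_half_subset

end StabilityAngle

end IMEX

theorem theorem5p1 :
    -- the largest `m > 0` admitting a method in the wedge whose stability region contains `A_m`
    IsGreatest {m : ℝ | 0 < m ∧ ∃ β ∈ IMEX.wedge, IMEX.sector m ⊆ IMEX.stabilityRegion β.1 β.2}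
      (1 / 2) ∧
    -- the optimum is attained by exactly one method
    (∀ β ∈ IMEX.wedge,
      IMEX.sector (1 / 2) ⊆ IMEX.stabilityRegion β.1 β.2 ↔ β = (3 / 8, 3 / 4)) ∧
    -- the optimal stability angle, and the uniqueness of the method having it
    IsGreatest ((fun β : ℝ × ℝ => IMEX.stabilityAngle β.1 β.2) '' IMEX.wedge)
      (Real.arctan (1 / 2)) ∧
    (∀ β ∈ IMEX.wedge,
      IMEX.stabilityAngle β.1 β.2 = Real.arctan (1 / 2) ↔ β = (3 / 8, 3 / 4)) := by
  refine ⟨⟨⟨by norm_num, _, IMEX.optimal_mem_wedge, IMEX.sector_half_subset⟩, ?_⟩, ?_,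
    ⟨⟨_, IMEX.optimal_mem_wedge, IMEX.stabilityAngle_optimal⟩, ?_⟩, ?_⟩
  · rintro m ⟨-, β, hβ, hsub⟩
    obtain ⟨μ, hμ, -, h⟩ := IMEX.exists_slope_bound hβ
    exact not_lt.1 fun hlt => h m (hμ.trans_lt hlt) hsub
  · intro β hβ
    refine ⟨fun hsub => ?_, ?_⟩
    · obtain ⟨μ, hμ, heq, h⟩ := IMEX.exists_slope_bound hβ
      exact heq (hμ.antisymm (not_lt.1 fun hlt => h _ hlt hsub))
    · rintro rfl
      exact IMEX.sector_half_subset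
  · rintro _ ⟨β, hβ, rfl⟩
    exact IMEX.stabilityAngle_le hβ
  · intro β hβ
    refine ⟨fun hang => ?_, ?_⟩
    · obtain ⟨μ, hμ, heq, h⟩ := IMEX.exists_slope_bound hβ
      refine heq (hμ.antisymm ?_)
      -- The bound μ comes without a sign, whereas the angle is never below its default 0; hence the
      -- maximum with 0.
      have hle := IMEX.stabilityAngle_le_arctan (le_max_right μ 0)
        fun m hm => h m ((le_max_left _ _).trans_lt hm)
      rw [hang, Real.arctan_strictMono.le_iff_le, le_max_iff] at hle
      exact hle.resolve_right (by norm_num)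
    · rintro rfl
      exact IMEX.stabilityAngle_optimal
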